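/- Let $H$ be a complex Hilbert space, $H\hat\otimes_2 H$ the Hilbertian tensor product (the completion of $H\otimes_{\mathbb C}H$ for the inner product with $\langle u\otimes v,u'\otimes v'\rangle=\langle u,u'\rangle\langle v,v'\rangle$), and let $\mu\colon H\hat\otimes_2 H\to H$ be a bounded linear map whose product $xy:=\mu(x\otimes y)$ is associative and commutative; no unit is assumed, and neither is the Frobenius condition. Let $\mu^\dagger\colon H\to H\hat\otimes_2 H$ be the Hilbert adjoint of $\mu$, and assume that $(H,\mu)$ is special, that is, $\mu\circ\mu^\dagger=\mathrm{id}_H$. Let $J$ be the Jacobson radical of $(H,\mu)$, that is, the intersection of all its maximal modular ideals ($J=H$ if there are none); an ideal $I$ is modular if there is $u\in H$ with $x-ux\in I$ for all $x\in H$. Let $G=\{x\in H\setminus\{0\} : \mu^\dagger(x)=x\otimes x\}$ be the set of group-like elements. For a closed subspace $V$ of $H$, view $V\hat\otimes_2 V$ as the closed subspace of $H\hat\otimes_2 H$ which is the range of the map $V\hat\otimes_2 V\to H\hat\otimes_2 H$ induced by the inclusion. Then: 1. $J$ is closed and $H=J\oplus_2 J^\perp$ (orthogonal direct sum of Hilbert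 spaces). 2. $J^\perp$ is a closed subalgebra of $(H,\mu)$: $\mu(J^\perp\hat\otimes_2 J^\perp)\subseteq J^\perp$. 3. $J^\perp$ is a closed subcoalgebra of $(H,\mu)$: $\mu^\dagger(J^\perp)\subseteq J^\perp\hat\otimes_2 J^\perp$. 4. For all $x,y\in G$, $xy=\delta_{x,y}\,x$, that is, $xx=x$, and $xy=0$ if $x\neq y$. -/

import Mathlib

open scoped TensorProduct

noncomputable section

namespace Hilbertian

section Tensor

variable (H K : Type*) [NormedAddCommGroup H] [InnerProductSpace ℂ H]
  [NormedAddCommGroup K] [InnerProductSpace ℂ K]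

/-- The Hilbertian tensor product: the completion of the algebraic tensor product for the inner
product determined by `⟪u ⊗ v, u' ⊗ v'⟫ = ⟪u, u'⟫ * ⟪v, v'⟫`. -/
abbrev HTensor : Type _ := UniformSpace.Completion (H ⊗[ℂ] K)

variable {H K}

/-- The elementary tensor `x ⊗ y` in the Hilbertian tensor product. -/
def tmul (x : H) (y : K) : HTensor H K := ((x ⊗ₜ[ℂ] y : H ⊗[ℂ] K) : HTensor H K)

/-- The Hilbertian tensor product `i ⊗ j` of two linear isometries: the bounded linear extension
of `v ⊗ w ↦ i v ⊗ j w`. -/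
def mapTensor {V W : Type*} [NormedAddCommGroup V] [InnerProductSpace ℂ V]
    [NormedAddCommGroup W] [InnerProductSpace ℂ W] (i : V →ₗᵢ[ℂ] H) (j : W →ₗᵢ[ℂ] K) :
    HTensor V W →L[ℂ] HTensor H K :=
  (TensorProduct.mapIsometry i j).toContinuousLinearMap.completion

/-- `mapTensor` acts on elementary tensors as it should. -/
theorem mapTensor_tmul {V W : Type*} [NormedAddCommGroup V] [InnerProductSpace ℂ V]
    [NormedAddCommGroup W] [InnerProductSpace ℂ W] (i : V →ₗᵢ[ℂ] H) (j : W →ₗᵢ[ℂ] K)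
    (v : V) (w : W) : mapTensor i j (tmul v w) = tmul (i v) (j w) := by
  simp [mapTensor, tmul]

/-- The Hilbertian tensor product of two subspaces, as a subspace of the Hilbertian tensor product
of the ambient spaces: the range of the map induced by the inclusions. -/
def subTensor (V : Submodule ℂ H) (W : Submodule ℂ K) : Submodule ℂ (HTensor H K) :=
  LinearMap.range (mapTensor V.subtypeₗᵢ W.subtypeₗᵢ).toLinearMap

end Tensor

/-- A Hilbertian algebra structure on a Hilbert space `H`: a bounded linear multiplication
defined on the Hilbertian tensor product, associative and commutative (by linearity and continuity,
it suffices to say so on elementary tensors). No unit is required. -/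
structure HilbertianAlgebra (H : Type*) [NormedAddCommGroup H] [InnerProductSpace ℂ H]
    [CompleteSpace H] where
  μ : HTensor H H →L[ℂ] H
  assoc : ∀ x y z : H, μ (tmul (μ (tmul x y)) z) = μ (tmul x (μ (tmul y z)))
  comm : ∀ x y : H, μ (tmul x y) = μ (tmul y x)

namespace HilbertianAlgebra

variable {H : Type*} [NormedAddCommGroup H] [InnerProductSpace ℂ H] [CompleteSpace H]
  (A : HilbertianAlgebra H)

/-- The product `xy = μ (x ⊗ y)`. -/
def mul (x y : H) : H := A.μ (tmul x y)

/-- The comultiplication: the Hilbert adjoint of the multiplication. -/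
def comul : H →L[ℂ] HTensor H H := ContinuousLinearMap.adjoint A.μ

/-- A Hilbertian algebra is special when `μ ∘ μ† = id`. -/
def IsSpecial : Prop := A.μ ∘L A.comul = ContinuousLinearMap.id ℂ H

/-- Ideals of the underlying algebra: not necessarily closed subspaces stable under multiplication
by arbitrary elements (one side suffices, by commutativity). -/
def IsIdeal (I : Submodule ℂ H) : Prop := ∀ x : H, ∀ y ∈ I, A.mul x y ∈ I

/-- Modular ideals: those for which the quotient algebra has a unit. -/
def IsModularIdeal (I : Submodule ℂ H) : Prop :=
  A.IsIdeal I ∧ ∃ u : H, ∀ x : H, x - A.mul u x ∈ I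

/-- Maximal modular ideals: modular ideals that are maximal among the proper ideals. -/
def IsMaximalModularIdeal (I : Submodule ℂ H) : Prop :=
  A.IsModularIdeal I ∧ I ≠ ⊤ ∧ ∀ K : Submodule ℂ H, A.IsIdeal K → I < K → K = ⊤

/-- The Jacobson radical: the intersection of all maximal modular ideals (the whole space when
there are none). -/
def jacobson : Submodule ℂ H := sInf {I | A.IsMaximalModularIdeal I}

/-- The group-like elements: the non-zero `x` with `μ† x = x ⊗ x`. -/
def groupLike : Set H := {x | x ≠ 0 ∧ A.comul x = tmul x x}

/-- A (closed) subalgebra: a closed subspace `V` with `μ (V ⊗ V) ⊆ V`. -/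
def IsSubalgebra (V : Submodule ℂ H) : Prop :=
  IsClosed (V : Set H) ∧ ∀ t ∈ subTensor V V, A.μ t ∈ V

/-- A (closed) subcoalgebra: a closed subspace `V` with `μ† V ⊆ V ⊗ V`. -/
def IsSubcoalgebra (V : Submodule ℂ H) : Prop :=
  IsClosed (V : Set H) ∧ ∀ x ∈ V, A.comul x ∈ subTensor V V

end HilbertianAlgebra

/-- `H` is the (internal) orthogonal direct sum of the Hilbert spaces `V` and `W`. -/
def IsOrthogonalDirectSum {H : Type*} [NormedAddCommGroup H] [InnerProductSpace ℂ H]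
    (V W : Submodule ℂ H) : Prop :=
  IsClosed (V : Set H) ∧ IsClosed (W : Set H) ∧ V ⟂ W ∧ IsCompl V W

end Hilbertian

end

/-! Nonzero continuous characters of `H` correspond, by Riesz representation, to group-like
elements, so the point is to produce enough characters. If `I` is a proper modular ideal with
modular unit `u`, every operator commuting with all multiplications preserves `I`. In the
bicommutant of the multiplications, a commutative unital Banach algebra, the operators sending `u`
into `I` therefore form a proper ideal; a character killing it (Gelfand–Mazur), composed with
`x ↦ (y ↦ xy)`, kills `I`. Consequently the maximal modular ideals are the hyperplanes `gᗮ` with `g`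
group-like, and `J` is the orthogonal complement of the group-like elements.

If the algebra is special, group-like elements are idempotent, which makes them orthonormal. The
product of two distinct ones is an idempotent killed by all characters, hence zero: a nonzero
idempotent `z` is a modular unit for the proper ideal `{x | zx = 0}`, so some character is nonzero
at `z`. -/

open scoped InnerProductSpace

namespace Hilbertian

section Characters

theorem apply_mem_of_modular {E S : Type*} [AddGroup E] [SetLike S E] [AddMemClass S E]
    {m : E → E → E} {I : S} (hcomm : ∀ x y, m x y = m y x) (hI : ∀ x, ∀ y ∈ I, m x y ∈ I) {u : E}
    (hu : ∀ x, x - m u x ∈ I) {T : E → E} (hT : ∀ x y, T (m x y) = m x (T y)) {y : E}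
    (hy : y ∈ I) : T y ∈ I := by
  have h_mul : m u (T y) ∈ I := by
    rw [← hT, hcomm, hT, hcomm]
    exact hI _ y hy
  simpa only [sub_add_cancel] using add_mem (hu (T y)) h_mul

variable {E : Type*} [NormedAddCommGroup E] [NormedSpace ℂ E] [CompleteSpace E]

theorem exists_character_of_invariant {R : Subalgebra ℂ (E →L[ℂ] E)}
    (hR : IsClosed (R : Set (E →L[ℂ] E))) (hcomm : ∀ S ∈ R, ∀ T ∈ R, S * T = T * S)
    {I : Submodule ℂ E} (hI : ∀ T ∈ R, ∀ y ∈ I, T y ∈ I) {u : E} (hu : u ∉ I) :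
    ∃ χ : WeakDual.characterSpace ℂ R, ∀ T : R, T.1 u ∈ I → χ T = 0 := by
  let _ : NormedCommRing R :=
    { (inferInstance : NormedRing R) with
      mul_comm := fun S T => Subtype.ext (hcomm S S.2 T T.2) }
  have : CompleteSpace R := hR.completeSpace_coe
  let N : Ideal R :=
    { carrier := {T | T.1 u ∈ I}
      zero_mem' := I.zero_mem
      add_mem' := I.add_mem
      smul_mem' := fun S _ hT => hI S S.2 _ hT }
  have hN : N ≠ ⊤ := (Ideal.ne_top_iff_one N).2 hu
  obtain ⟨M, hM, hNM⟩ := N.exists_le_maximal hN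
  exact ⟨M.toCharacterSpace, fun T hT => M.toCharacterSpace_apply_eq_zero_of_mem (hNM hT)⟩

theorem exists_character_of_modular {m : E →L[ℂ] E →L[ℂ] E} (hcomm : ∀ x y, m x y = m y x)
    (hassoc : ∀ x y z, m (m x y) z = m x (m y z)) {I : Submodule ℂ E}
    (hI : ∀ x, ∀ y ∈ I, m x y ∈ I) (hne : I ≠ ⊤) {u : E} (hu : ∀ x, x - m u x ∈ I) :
    ∃ φ : E →L[ℂ] ℂ, (∀ x y, φ (m x y) = φ x * φ y) ∧ (∀ x ∈ I, φ x = 0) ∧ φ u = 1 := by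
  let R : Subalgebra ℂ (E →L[ℂ] E) := .centralizer ℂ (Set.centralizer (Set.range m))
  have hm_mul (x y : E) : m (m x y) = m x * m y := ContinuousLinearMap.ext (hassoc x y)
  have hm_comm : ∀ S ∈ Set.range m, ∀ T ∈ Set.range m, S * T = T * S := by
    rintro _ ⟨x, rfl⟩ _ ⟨y, rfl⟩
    rw [← hm_mul, hcomm, hm_mul]
  have hm_mem (x : E) : m x ∈ R := Set.subset_centralizer_centralizer ⟨x, rfl⟩
  have hR_comm := Set.centralizer_centralizer_comm_of_comm hm_comm
  have hR : IsClosed (R : Set (E →L[ℂ] E)) := Set.isClosed_centralizer _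
  have hR_inv : ∀ T ∈ R, ∀ y ∈ I, T y ∈ I := fun T hT y =>
    apply_mem_of_modular hcomm hI hu fun x y => DFunLike.congr_fun (hR_comm T hT _ (hm_mem x)) y
  have hu_notMem : u ∉ I := fun huI => hne <| eq_top_iff.2 fun x _ => by
    simpa only [hcomm u, sub_add_cancel] using I.add_mem (hu x) (hI x u huI)
  obtain ⟨χ, hχ⟩ := exists_character_of_invariant hR hR_comm hR_inv hu_notMem
  let φ : E →L[ℂ] ℂ :=
    WeakDual.CharacterSpace.toCLM χ ∘L m.codRestrict (Subalgebra.toSubmodule R) hm_mem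
  have hφ (x : E) : φ x = χ ⟨m x, hm_mem x⟩ := rfl
  refine ⟨φ, fun x y => ?_, fun x hx => hχ _ ?_, ?_⟩
  · rw [hφ, hφ, hφ, ← map_mul]
    exact congrArg χ (Subtype.ext (hm_mul x y))
  · exact hcomm x u ▸ hI u x hx
  · have h_unit : χ (1 - ⟨m u, hm_mem u⟩) = 0 := hχ _ (hu u)
    rwa [map_sub, map_one, sub_eq_zero, eq_comm] at h_unit

end Characters

theorem apply_mem_topologicalClosure_span {𝕜 E : Type*} [NontriviallyNormedField 𝕜]
    [NormedAddCommGroup E] [NormedSpace 𝕜 E] {m : E →L[𝕜] E →L[𝕜] E} {s : Set E}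
    (hs : ∀ x ∈ s, ∀ y ∈ s, m x y ∈ Submodule.span 𝕜 s) {x y : E}
    (hx : x ∈ (Submodule.span 𝕜 s).topologicalClosure)
    (hy : y ∈ (Submodule.span 𝕜 s).topologicalClosure) :
    m x y ∈ (Submodule.span 𝕜 s).topologicalClosure := by
  have h_span : Submodule.map₂ m.toLinearMap₁₂ (.span 𝕜 s) (.span 𝕜 s) ≤ .span 𝕜 s := by
    rw [Submodule.map₂_span_span, Submodule.span_le]
    exact Set.image2_subset_iff.2 hs
  exact map_mem_closure₂ (f := fun x y => m x y) m.continuous₂ hx hy fun x hx y hy =>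
    h_span (Submodule.apply_mem_map₂ m.toLinearMap₁₂ hx hy)

theorem isCoatom_orthogonal_span_singleton {𝕜 E : Type*} [RCLike 𝕜] [NormedAddCommGroup E]
    [InnerProductSpace 𝕜 E] {g : E} (hg : g ≠ 0) : IsCoatom (𝕜 ∙ g)ᗮ := by
  have h_ne : (innerSL 𝕜 g).toLinearMap ≠ 0 := fun h =>
    hg (inner_self_eq_zero.1 (DFunLike.congr_fun h g))
  convert LinearMap.isCoatom_ker_of_surjective (LinearMap.surjective h_ne)
  ext x
  exact Submodule.mem_orthogonal_singleton_iff_inner_right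

section Tensor

variable {H K : Type*} [NormedAddCommGroup H] [InnerProductSpace ℂ H]
  [NormedAddCommGroup K] [InnerProductSpace ℂ K]

theorem inner_tmul_tmul (x x' : H) (y y' : K) :
    ⟪tmul x y, tmul x' y'⟫_ℂ = ⟪x, x'⟫_ℂ * ⟪y, y'⟫_ℂ := by
  simp [tmul, UniformSpace.Completion.inner_coe]

theorem dense_span_range_tmul :
    Dense (Submodule.span ℂ (Set.range fun p : H × K => tmul p.1 p.2) : Set (HTensor H K)) := by
  refine UniformSpace.Completion.denseRange_coe.mono ?_
  rintro _ ⟨t, rfl⟩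
  induction t using TensorProduct.induction_on with
  | zero => exact Submodule.zero_mem _
  | tmul x y => exact Submodule.subset_span ⟨(x, y), rfl⟩
  | add s t hs ht =>
    rw [UniformSpace.Completion.coe_add]
    exact Submodule.add_mem _ hs ht

theorem HTensor.ext_inner_right {s t : HTensor H K}
    (h : ∀ x y, ⟪s, tmul x y⟫_ℂ = ⟪t, tmul x y⟫_ℂ) : s = t := by
  have h_functional : innerSL ℂ s = innerSL ℂ t :=
    ContinuousLinearMap.ext_on dense_span_range_tmul (by rintro _ ⟨p, rfl⟩; exact h p.1 p.2)
  exact _root_.ext_inner_right ℂ (DFunLike.congr_fun h_functional)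

theorem tmul_mem_subTensor {V : Submodule ℂ H} {W : Submodule ℂ K} {x : H} {y : K} (hx : x ∈ V)
    (hy : y ∈ W) : tmul x y ∈ subTensor V W :=
  ⟨tmul ⟨x, hx⟩ ⟨y, hy⟩, mapTensor_tmul _ _ _ _⟩

theorem isClosed_subTensor (V : Submodule ℂ H) (W : Submodule ℂ K) :
    IsClosed (subTensor V W : Set (HTensor H K)) := by
  have h_isometry : Isometry (mapTensor V.subtypeₗᵢ W.subtypeₗᵢ) :=
    (TensorProduct.mapIsometry V.subtypeₗᵢ W.subtypeₗᵢ).isometry.completion_map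
  exact h_isometry.isClosedEmbedding.isClosed_range

theorem subTensor_le_iff {V : Submodule ℂ H} {W : Submodule ℂ K} {S : Submodule ℂ (HTensor H K)}
    (hS : IsClosed (S : Set (HTensor H K))) :
    subTensor V W ≤ S ↔ ∀ x ∈ V, ∀ y ∈ W, tmul x y ∈ S := by
  refine ⟨fun h x hx y hy => h (tmul_mem_subTensor hx hy), fun h => ?_⟩
  let f := mapTensor V.subtypeₗᵢ W.subtypeₗᵢ
  have h_span : Submodule.span ℂ (Set.range fun p : V × W => tmul p.1 p.2) ≤
      S.comap f.toLinearMap := by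
    rw [Submodule.span_le]
    rintro _ ⟨⟨v, w⟩, rfl⟩
    change f (tmul v w) ∈ S
    rw [mapTensor_tmul]
    exact h v v.2 w w.2
  rintro _ ⟨t, rfl⟩
  exact Submodule.topologicalClosure_minimal _ h_span (hS.preimage f.continuous)
    (dense_span_range_tmul t)

end Tensor

namespace HilbertianAlgebra

variable {H : Type*} [NormedAddCommGroup H] [InnerProductSpace ℂ H] [CompleteSpace H]
  {A : HilbertianAlgebra H}

/-- The product as a bounded bilinear map: `A.mulL x` is the operator of multiplication by `x`. -/
noncomputable def mulL (A : HilbertianAlgebra H) : H →L[ℂ] H →L[ℂ] H :=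
  .compL ℂ H (H ⊗[ℂ] H) H (A.μ ∘L UniformSpace.Completion.toComplL) ∘L TensorProduct.mkL ℂ H H

theorem mulL_apply (x y : H) : A.mulL x y = A.mul x y := rfl

theorem mul_assoc (x y z : H) : A.mul (A.mul x y) z = A.mul x (A.mul y z) :=
  A.assoc x y z

theorem mul_comm (x y : H) : A.mul x y = A.mul y x :=
  A.comm x y

theorem isSubalgebra_iff {V : Submodule ℂ H} :
    A.IsSubalgebra V ↔ IsClosed (V : Set H) ∧ ∀ x ∈ V, ∀ y ∈ V, A.mul x y ∈ V :=
  and_congr_right fun hV =>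
    subTensor_le_iff (S := V.comap A.μ.toLinearMap) (hV.preimage A.μ.continuous)

theorem inner_comul_left (x : H) (t : HTensor H H) : ⟪A.comul x, t⟫_ℂ = ⟪x, A.μ t⟫_ℂ :=
  ContinuousLinearMap.adjoint_inner_left _ _ _

theorem comul_eq_tmul_self_iff {g : H} :
    A.comul g = tmul g g ↔ ∀ x y, ⟪g, A.mul x y⟫_ℂ = ⟪g, x⟫_ℂ * ⟪g, y⟫_ℂ := by
  refine ⟨fun hg x y => ?_, fun h => HTensor.ext_inner_right fun x y => ?_⟩
  · rw [← inner_tmul_tmul, ← hg, inner_comul_left, mul]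
  · rw [inner_comul_left, inner_tmul_tmul]
    exact h x y

theorem inner_mul_of_mem_groupLike {g : H} (hg : g ∈ A.groupLike) (x y : H) :
    ⟪g, A.mul x y⟫_ℂ = ⟪g, x⟫_ℂ * ⟪g, y⟫_ℂ :=
  comul_eq_tmul_self_iff.1 hg.2 x y

theorem exists_groupLike_of_isModularIdeal {I : Submodule ℂ H} (hI : A.IsModularIdeal I)
    (hne : I ≠ ⊤) : ∃ g ∈ A.groupLike, I ≤ (ℂ ∙ g)ᗮ := by
  obtain ⟨hI, u, hu⟩ := hI
  obtain ⟨φ, hφ_mul, hφ_I, hφ_u⟩ :=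
    exists_character_of_modular (m := A.mulL) A.mul_comm A.mul_assoc hI hne hu
  obtain ⟨g, rfl⟩ := (InnerProductSpace.toDual ℂ H).surjective φ
  refine ⟨g, ⟨?_, comul_eq_tmul_self_iff.2 hφ_mul⟩, fun x hx => ?_⟩
  · rintro rfl
    simp at hφ_u
  · exact Submodule.mem_orthogonal_singleton_iff_inner_right.2 (hφ_I x hx)

theorem isModularIdeal_orthogonal_groupLike {g : H} (hg : g ∈ A.groupLike) :
    A.IsModularIdeal (ℂ ∙ g)ᗮ := by
  refine ⟨fun x y hy => ?_, (⟪g, g⟫_ℂ)⁻¹ • g, fun x => ?_⟩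
  · rw [Submodule.mem_orthogonal_singleton_iff_inner_right] at hy ⊢
    rw [inner_mul_of_mem_groupLike hg, hy, mul_zero]
  · rw [Submodule.mem_orthogonal_singleton_iff_inner_right, inner_sub_right,
      inner_mul_of_mem_groupLike hg, inner_smul_right, inv_mul_cancel₀ (inner_self_ne_zero.2 hg.1),
      one_mul, sub_self]

theorem isMaximalModularIdeal_iff {I : Submodule ℂ H} :
    A.IsMaximalModularIdeal I ↔ ∃ g ∈ A.groupLike, I = (ℂ ∙ g)ᗮ := by
  constructor
  · rintro ⟨hI, hne, hmax⟩
    obtain ⟨g, hg, hle⟩ := exists_groupLike_of_isModularIdeal hI hne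
    exact ⟨g, hg, hle.eq_of_not_lt fun hlt => (isCoatom_orthogonal_span_singleton hg.1).1
      (hmax _ (isModularIdeal_orthogonal_groupLike hg).1 hlt)⟩
  · rintro ⟨g, hg, rfl⟩
    obtain ⟨hne, hmax⟩ := isCoatom_orthogonal_span_singleton (𝕜 := ℂ) hg.1
    exact ⟨isModularIdeal_orthogonal_groupLike hg, hne, fun K _ => hmax K⟩

theorem jacobson_eq_iInf (A : HilbertianAlgebra H) : A.jacobson = ⨅ g ∈ A.groupLike, (ℂ ∙ g)ᗮ := by
  have h_image : {I | A.IsMaximalModularIdeal I} = (fun g => (ℂ ∙ g)ᗮ) '' A.groupLike := by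
    ext I
    simp only [isMaximalModularIdeal_iff, Set.mem_ofPred_eq, Set.mem_image, eq_comm (a := I)]
  rw [jacobson, h_image, sInf_image]

theorem mem_jacobson_iff {x : H} : x ∈ A.jacobson ↔ ∀ g ∈ A.groupLike, ⟪g, x⟫_ℂ = 0 := by
  simp only [jacobson_eq_iInf, Submodule.mem_iInf,
    Submodule.mem_orthogonal_singleton_iff_inner_right]

theorem jacobson_eq_orthogonal_span_groupLike (A : HilbertianAlgebra H) :
    A.jacobson = (Submodule.span ℂ A.groupLike)ᗮ := by
  rw [jacobson_eq_iInf, Submodule.span_eq_iSup_of_singleton_spans, iSup_subtype', iInf_subtype',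
    Submodule.iInf_orthogonal]

theorem orthogonal_jacobson (A : HilbertianAlgebra H) :
    A.jacobsonᗮ = (Submodule.span ℂ A.groupLike).topologicalClosure := by
  rw [jacobson_eq_orthogonal_span_groupLike, Submodule.orthogonal_orthogonal_eq_closure]

theorem isOrthogonalDirectSum_jacobson (A : HilbertianAlgebra H) :
    IsOrthogonalDirectSum A.jacobson A.jacobsonᗮ := by
  have h_closed : IsClosed (A.jacobson : Set H) := by
    rw [jacobson_eq_orthogonal_span_groupLike]
    exact Submodule.isClosed_orthogonal _
  have : CompleteSpace A.jacobson := h_closed.completeSpace_coe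
  exact ⟨h_closed, Submodule.isClosed_orthogonal _, Submodule.isOrtho_orthogonal_right _,
    Submodule.isCompl_orthogonal _⟩

theorem isSubcoalgebra_topologicalClosure_span {s : Set H} (hs : s ⊆ A.groupLike) :
    A.IsSubcoalgebra (Submodule.span ℂ s).topologicalClosure := by
  set V := (Submodule.span ℂ s).topologicalClosure
  have hsV : s ⊆ V := Submodule.subset_span.trans (Submodule.le_topologicalClosure _)
  have h_span : Submodule.span ℂ s ≤ (subTensor V V).comap A.comul.toLinearMap := by
    refine Submodule.span_le.2 fun g hg => ?_
    change A.comul g ∈ subTensor V V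
    rw [(hs hg).2]
    exact tmul_mem_subTensor (hsV hg) (hsV hg)
  exact ⟨Submodule.isClosed_topologicalClosure _, Submodule.topologicalClosure_minimal _ h_span
    ((isClosed_subTensor V V).preimage A.comul.continuous)⟩

theorem eq_zero_of_mul_self_of_mem_jacobson {z : H} (hz : A.mul z z = z) (hzJ : z ∈ A.jacobson) :
    z = 0 := by
  by_contra hz0
  let I := (A.mulL z).ker
  have hI : A.IsIdeal I := fun x y (hy : A.mul z y = 0) => by
    change A.mul z (A.mul x y) = 0
    rw [← mul_assoc, mul_comm z x, mul_assoc, hy, ← mulL_apply, map_zero]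
  have hI_unit (x : H) : x - A.mul z x ∈ I := by
    change A.mulL z (x - A.mul z x) = 0
    rw [map_sub, mulL_apply, mulL_apply, ← mul_assoc, hz, sub_self]
  have hne : I ≠ ⊤ := fun h_top => by
    have hzI : A.mul z z = 0 := (h_top ▸ Submodule.mem_top : z ∈ I)
    exact hz0 (hz.symm.trans hzI)
  obtain ⟨g, hg, hIg⟩ := exists_groupLike_of_isModularIdeal ⟨hI, z, hI_unit⟩ hne
  have hgz : ⟪g, z⟫_ℂ = 0 := mem_jacobson_iff.1 hzJ g hg
  have hgg : ⟪g, g - A.mul z g⟫_ℂ = 0 :=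
    Submodule.mem_orthogonal_singleton_iff_inner_right.1 (hIg (hI_unit g))
  rw [inner_sub_right, inner_mul_of_mem_groupLike hg, hgz, zero_mul, sub_zero] at hgg
  exact hg.1 (inner_self_eq_zero.1 hgg)

namespace IsSpecial

theorem mul_self_of_mem_groupLike (hA : A.IsSpecial) {g : H} (hg : g ∈ A.groupLike) :
    A.mul g g = g := by
  rw [mul, ← hg.2]
  exact DFunLike.congr_fun hA g

theorem orthonormal_groupLike (hA : A.IsSpecial) :
    Orthonormal ℂ ((↑) : A.groupLike → H) := by
  have h_sq {x y : H} (hx : x ∈ A.groupLike) (hy : y ∈ A.groupLike) :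
      ⟪x, y⟫_ℂ * ⟪x, y⟫_ℂ = ⟪x, y⟫_ℂ := by
    rw [← inner_mul_of_mem_groupLike hx, hA.mul_self_of_mem_groupLike hy]
  have h_norm (x : A.groupLike) : ‖(x : H)‖ = 1 := by
    have h_inner : ⟪(x : H), x⟫_ℂ = 1 :=
      (mul_eq_left₀ (inner_self_ne_zero.2 x.2.1)).1 (h_sq x.2 x.2)
    rw [norm_eq_sqrt_re_inner (𝕜 := ℂ), h_inner, RCLike.one_re, Real.sqrt_one]
  refine ⟨h_norm, fun x y hxy => ?_⟩
  by_contra h_inner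
  have h_one : ⟪(x : H), y⟫_ℂ = 1 := (mul_eq_left₀ h_inner).1 (h_sq x.2 y.2)
  exact hxy (Subtype.ext ((inner_eq_one_iff_of_norm_eq_one (h_norm x) (h_norm y)).1 h_one))

theorem mul_eq_zero_of_mem_groupLike (hA : A.IsSpecial) {x y : H} (hx : x ∈ A.groupLike)
    (hy : y ∈ A.groupLike) (hxy : x ≠ y) : A.mul x y = 0 := by
  apply eq_zero_of_mul_self_of_mem_jacobson (A := A)
  · rw [mul_assoc, ← mul_assoc y x y, mul_comm y x, mul_assoc x y y, ← mul_assoc x x,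
      hA.mul_self_of_mem_groupLike hx, hA.mul_self_of_mem_groupLike hy]
  · refine mem_jacobson_iff.2 fun g hg => ?_
    rw [inner_mul_of_mem_groupLike hg, mul_eq_zero]
    rcases eq_or_ne g x with rfl | hgx
    · exact .inr (hA.orthonormal_groupLike.2 (i := ⟨g, hg⟩) (j := ⟨y, hy⟩) (by simpa using hxy))
    · exact .inl (hA.orthonormal_groupLike.2 (i := ⟨g, hg⟩) (j := ⟨x, hx⟩) (by simpa using hgx))

theorem isSubalgebra_topologicalClosure_span (hA : A.IsSpecial) {s : Set H}
    (hs : s ⊆ A.groupLike) : A.IsSubalgebra (Submodule.span ℂ s).topologicalClosure := by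
  have h_mul : ∀ x ∈ s, ∀ y ∈ s, A.mulL x y ∈ Submodule.span ℂ s := by
    intro x hx y hy
    rw [mulL_apply]
    rcases eq_or_ne x y with rfl | hxy
    · exact (hA.mul_self_of_mem_groupLike (hs hx)).symm ▸ Submodule.subset_span hx
    · exact (hA.mul_eq_zero_of_mem_groupLike (hs hx) (hs hy) hxy).symm ▸ Submodule.zero_mem _
  exact isSubalgebra_iff.2 ⟨Submodule.isClosed_topologicalClosure _,
    fun _ hx _ hy => apply_mem_topologicalClosure_span h_mul hx hy⟩

end IsSpecial

end HilbertianAlgebra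

end Hilbertian

theorem mainTheorem10 {H : Type*} [NormedAddCommGroup H] [InnerProductSpace ℂ H] [CompleteSpace H]
    [DecidableEq H]     (A : Hilbertian.HilbertianAlgebra H) (hA : A.IsSpecial) :
    Hilbertian.IsOrthogonalDirectSum A.jacobson A.jacobsonᗮ ∧
    A.IsSubalgebra A.jacobsonᗮ ∧
    A.IsSubcoalgebra A.jacobsonᗮ ∧
    ∀ x ∈ A.groupLike, ∀ y ∈ A.groupLike, A.mul x y = if x = y then x else 0 := by
  refine ⟨A.isOrthogonalDirectSum_jacobson, ?_, ?_, fun x hx y hy => ?_⟩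
  · rw [A.orthogonal_jacobson]
    exact hA.isSubalgebra_topologicalClosure_span subset_rfl
  · rw [A.orthogonal_jacobson]
    exact A.isSubcoalgebra_topologicalClosure_span subset_rfl
  · split_ifs with hxy
    · exact hxy ▸ hA.mul_self_of_mem_groupLike hx
    · exact hA.mul_eq_zero_of_mem_groupLike hx hy hxy
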